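/- A commuting $m$-tuple $(T_1,\dots,T_m)$ of linear operators on $\mathbb{C}^n$ is called hypercyclic if there is a vector $x\in\mathbb{C}^n$ whose orbit $\{T_1^{k_1}\cdots T_m^{k_m}x : k_1,\dots,k_m\in\mathbb{Z},\ k_j\ge 0\}$ is dense in $\mathbb{C}^n$. The tuple is called diagonalizable if there is a basis of $\mathbb{C}^n$ consisting of common eigenvectors of $T_1,\dots,T_m$. Let $n\ge 1$. Then the smallest $m$ for which there is a hypercyclic $m$-tuple of operators on $\mathbb{C}^n$ is exactly $n+1$; in particular, there is no hypercyclic $n$-tuple of operators on $\mathbb{C}^n$. If, moreover, $n\ge 2$, then the smallest $m$ for which there is a non-diagonalizable hypercyclic $m$-tuple of operators on $\mathbb{C}^n$ is exactly $n+2$. -/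

import Mathlib

universe u

/-- The family `F_T = {T₁ ^ k₁ ⋯ Tₘ ^ kₘ : kⱼ ∈ ℤ₊}` attached to an `m`-tuple of continuous linear
operators (the products are taken in the displayed order). -/
def tupleSemigroup {𝕜 X : Type*} [Field 𝕜] [TopologicalSpace X] [AddCommGroup X] [Module 𝕜 X]
    {m : ℕ} (T : Fin m → X →L[𝕜] X) : Set (X →L[𝕜] X) :=
  {S | ∃ k : Fin m → ℕ, S = (List.ofFn fun j => T j ^ k j).prod}

/-- A family of continuous linear operators is universal if some vector has a dense orbit. -/
def IsUniversalFamily {𝕜 X : Type*} [Field 𝕜] [TopologicalSpace X] [AddCommGroup X]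
    [Module 𝕜 X] (F : Set (X →L[𝕜] X)) : Prop :=
  ∃ x : X, Dense {y : X | ∃ S ∈ F, y = S x}

/-- A hypercyclic tuple: its members commute pairwise and the family `F_T` is universal. -/
def IsHypercyclicTuple {𝕜 X : Type*} [Field 𝕜] [TopologicalSpace X] [AddCommGroup X]
    [Module 𝕜 X] {m : ℕ} (T : Fin m → X →L[𝕜] X) : Prop :=
  (∀ j k, T j * T k = T k * T j) ∧ IsUniversalFamily (tupleSemigroup T)

/-- A tuple of operators is diagonalizable if there is a basis of the space in which every member
of the tuple has a diagonal matrix, that is, a basis of common eigenvectors. -/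
def IsDiagonalizableTuple {𝕜 : Type*} {X : Type u} [Field 𝕜] [TopologicalSpace X] [AddCommGroup X]
    [Module 𝕜 X] {m : ℕ} (T : Fin m → X →L[𝕜] X) : Prop :=
  ∃ (ι : Type u) (b : Module.Basis ι 𝕜 X), ∀ j i, ∃ c : 𝕜, T j (b i) = c • b i

open Filter Topology

section ExpUnits

variable {A : Type*} [NormedCommRing A] [NormedAlgebra ℂ A] [CompleteSpace A]

theorem exp_add_of_complex (a b : A) :
    NormedSpace.exp (a + b) = NormedSpace.exp a * NormedSpace.exp b :=
  letI : NormedAlgebra ℚ A := .restrictScalars ℚ ℂ A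
  NormedSpace.exp_add

theorem isUnit_exp_of_complex (a : A) : IsUnit (NormedSpace.exp a) :=
  letI : NormedAlgebra ℚ A := .restrictScalars ℚ ℂ A
  NormedSpace.isUnit_exp a

theorem exp_nsmul_of_complex (k : ℕ) (a : A) :
    NormedSpace.exp (k • a) = NormedSpace.exp a ^ k :=
  letI : NormedAlgebra ℚ A := .restrictScalars ℚ ℂ A
  NormedSpace.exp_nsmul k a

theorem exp_sum_of_complex {ι : Type*} (s : Finset ι) (f : ι → A) :
    NormedSpace.exp (∑ i ∈ s, f i) = ∏ i ∈ s, NormedSpace.exp (f i) :=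
  letI : NormedAlgebra ℚ A := .restrictScalars ℚ ℂ A
  NormedSpace.exp_sum s f

theorem continuous_exp_of_complex : Continuous (NormedSpace.exp : A → A) :=
  letI : NormedAlgebra ℚ A := .restrictScalars ℚ ℂ A
  NormedSpace.exp_continuous

theorem exp_mul_exp_neg (a : A) : NormedSpace.exp a * NormedSpace.exp (-a) = 1 := by
  rw [← exp_add_of_complex, add_neg_cancel, NormedSpace.exp_zero]

theorem map_exp_nhds_zero : map (NormedSpace.exp : A → A) (𝓝 0) = 𝓝 1 := by
  have h : HasStrictFDerivAt (NormedSpace.exp : A → A)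
      ((ContinuousLinearEquiv.refl ℂ A : A ≃L[ℂ] A) : A →L[ℂ] A) 0 :=
    hasStrictFDerivAt_exp_zero
  simpa using h.map_nhds_eq_of_equiv

theorem range_exp_mem_nhds_one : Set.range (NormedSpace.exp : A → A) ∈ 𝓝 (1 : A) := by
  rw [← map_exp_nhds_zero]
  exact Filter.range_mem_map

/-- A unit has a neighbourhood contained in the coset of the range of the exponential. -/
theorem eventually_eq_mul_exp {u : A} (hu : IsUnit u) :
    ∀ᶠ x in 𝓝 u, ∃ a, x = u * NormedSpace.exp a := by
  obtain ⟨v, hv⟩ := hu.exists_right_inv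
  have hc : Tendsto (fun x => v * x) (𝓝 u) (𝓝 1) := by
    have : Tendsto (fun x => v * x) (𝓝 u) (𝓝 (v * u)) :=
      (continuous_const.mul continuous_id).tendsto u
    rwa [mul_comm v u, hv] at this
  filter_upwards [hc range_exp_mem_nhds_one] with x hx
  obtain ⟨a, ha⟩ := hx
  exact ⟨a, by rw [ha, ← mul_assoc, hv, one_mul]⟩

theorem isOpen_range_exp : IsOpen (Set.range (NormedSpace.exp : A → A)) := by
  rw [isOpen_iff_mem_nhds]
  rintro _ ⟨a, rfl⟩
  filter_upwards [eventually_eq_mul_exp (isUnit_exp_of_complex a)] with x hx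
  obtain ⟨b, rfl⟩ := hx
  exact ⟨a + b, exp_add_of_complex a b⟩

theorem isOpen_isUnit_diff_range_exp :
    IsOpen {u : A | IsUnit u ∧ u ∉ Set.range (NormedSpace.exp : A → A)} := by
  rw [isOpen_iff_mem_nhds]
  rintro u ⟨hu, hu'⟩
  filter_upwards [eventually_eq_mul_exp hu] with x hx
  obtain ⟨b, rfl⟩ := hx
  refine ⟨hu.mul (isUnit_exp_of_complex b), ?_⟩
  rintro ⟨c, hc⟩
  refine hu' ⟨c + -b, ?_⟩
  rw [exp_add_of_complex, hc, mul_assoc, exp_mul_exp_neg, mul_one]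

end ExpUnits

section FiniteDimensional

variable {A : Type*} [NormedCommRing A] [NormedAlgebra ℂ A] [FiniteDimensional ℂ A]

theorem spectrum_finite_of_finiteDimensional (a : A) : (spectrum ℂ a).Finite := by
  refine (Module.End.finite_spectrum (Algebra.lmul ℂ A a)).subset fun z hz hz' => hz ?_
  have : (algebraMap ℂ (Module.End ℂ A) z - Algebra.lmul ℂ A a) =
      Algebra.lmul ℂ A (algebraMap ℂ A z - a) := by
    rw [map_sub, AlgHom.commutes]
  have h2 : IsUnit (algebraMap ℂ (Module.End ℂ A) z - Algebra.lmul ℂ A a) := hz'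
  rw [this, Algebra.lmul_isUnit_iff] at h2
  exact h2

theorem dense_isUnit : Dense {u : A | IsUnit u} := by
  intro a
  have h : Dense (spectrum ℂ a)ᶜ :=
    (spectrum_finite_of_finiteDimensional a).countable.dense_compl ℝ
  have hc : Continuous fun z : ℂ => a - algebraMap ℂ A z := by fun_prop
  have := map_mem_closure hc (h 0) (t := {u : A | IsUnit u}) fun z hz => by
    have h1 : IsUnit (algebraMap ℂ A z - a) := not_not.mp hz
    simpa using h1.neg
  simpa using this

theorem isUnit_iff_exists_exp_eq {u : A} :
    IsUnit u ↔ ∃ a, NormedSpace.exp a = u := by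
  have : CompleteSpace A := FiniteDimensional.complete ℂ A
  refine ⟨fun hu => ?_, by rintro ⟨a, rfl⟩; exact isUnit_exp_of_complex a⟩
  by_contra hne
  have hcount : {z : ℂ | ¬ IsUnit (1 + z • (u - 1))}.Countable := by
    refine ((spectrum_finite_of_finiteDimensional (u - 1)).image
      (fun w => -w⁻¹)).countable.mono fun z hz => ?_
    have hz0 : z ≠ 0 := by rintro rfl; simp at hz
    refine ⟨-z⁻¹, fun h => hz ?_, by simp⟩
    have h1 : IsUnit (algebraMap ℂ A (-z⁻¹) - (u - 1)) := h
    have h2 : IsUnit (algebraMap ℂ A (-z)) := (IsUnit.mk0 _ (neg_ne_zero.mpr hz0)).map _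
    have h3 := h2.mul h1
    rw [mul_sub, ← map_mul] at h3
    have : -z * -z⁻¹ = 1 := by field_simp
    rw [this, map_one, map_neg, neg_mul, sub_neg_eq_add, ← Algebra.smul_def] at h3
    exact h3
  have hconn : IsConnected {z : ℂ | ¬ IsUnit (1 + z • (u - 1))}ᶜ :=
    hcount.isConnected_compl_of_one_lt_rank (by simp [Complex.rank_real_complex])
  have hf : Continuous fun z : ℂ => 1 + z • (u - 1) := by fun_prop
  obtain ⟨z, -, hz, hz'⟩ := hconn.isPreconnected _ _ (isOpen_range_exp.preimage hf)
    (isOpen_isUnit_diff_range_exp.preimage hf)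
    (fun z hz => by
      have hz1 : IsUnit (1 + z • (u - 1)) := not_not.mp hz
      by_cases h : 1 + z • (u - 1) ∈ Set.range (NormedSpace.exp : A → A)
      · exact Or.inl h
      · exact Or.inr ⟨hz1, h⟩)
    ⟨0, by simp, ⟨0, by simp⟩⟩
    ⟨1, by simpa using hu, by simpa using hu, by simpa using hne⟩
  exact hz'.2 hz

end FiniteDimensional

/-- Approximation of `q` modulo `1` by large multiples of `c`. -/
theorem dense_setOf_exists_int_near {ι : Type*} [Fintype ι] (q : ι → ℝ) (M : ℕ) {ε : ℝ}
    (hε : 0 < ε) :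
    Dense {c : ι → ℝ | ∃ N : ℕ, M ≤ N ∧ ∃ k : ι → ℤ, ∀ i, |(k i : ℝ) - N * c i - q i| < ε} := by
  rw [Metric.dense_iff]
  intro c δ hδ
  obtain ⟨L, hL⟩ := exists_nat_gt (1 / δ)
  have hN : 1 / δ < ((M + L : ℕ) : ℝ) := by push_cast; linarith [(Nat.cast_nonneg M : (0 : ℝ) ≤ M)]
  have hN0 : (0 : ℝ) < ((M + L : ℕ) : ℝ) := lt_trans (by positivity) hN
  set N : ℕ := M + L
  refine ⟨fun i => ((round (N * c i + q i) : ℝ) - q i) / N, ?_, N, by omega,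
    fun i => round (N * c i + q i), fun i => ?_⟩
  · rw [Metric.mem_ball, dist_pi_lt_iff hδ]
    intro i
    rw [Real.dist_eq]
    have h1 : ((round (N * c i + q i) : ℝ) - q i) / N - c i =
        ((round (N * c i + q i) : ℝ) - (N * c i + q i)) / N := by field_simp; ring
    rw [h1, abs_div, abs_of_pos hN0, div_lt_iff₀ hN0, abs_sub_comm]
    rw [div_lt_iff₀ hδ] at hN
    linarith [abs_sub_round (N * c i + q i)]
  · have : (round (N * c i + q i) : ℝ) - N * (((round (N * c i + q i) : ℝ) - q i) / N) - q i = 0 := by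
      field_simp; ring
    rw [this, abs_zero]
    exact hε

theorem isOpen_setOf_exists_int_near {ι : Type*} [Fintype ι] (q : ι → ℝ) (M : ℕ) (ε : ℝ) :
    IsOpen {c : ι → ℝ | ∃ N : ℕ, M ≤ N ∧ ∃ k : ι → ℤ, ∀ i, |(k i : ℝ) - N * c i - q i| < ε} := by
  simp only [Set.ofPred_exists, Set.ofPred_and, Set.ofPred_forall]
  refine isOpen_iUnion fun N => isOpen_const.inter <| isOpen_iUnion fun k =>
    isOpen_iInter_of_finite fun i => isOpen_lt (by fun_prop) continuous_const

/-- For generic positive `c`, the additive semigroup generated by the standard basis vectors and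
`-c` is dense in `ℝ^ι`. -/
theorem exists_dense_natCast_sub_natCast_mul (ι : Type*) [Fintype ι] :
    ∃ c : ι → ℝ, Dense {x : ι → ℝ | ∃ (N : ℕ) (k : ι → ℕ), x = fun i => (k i : ℝ) - N * c i} := by
  have hD := dense_iInter_of_isOpen
    (f := fun p : ℕ × (ι → ℚ) => {c : ι → ℝ | ∃ N : ℕ, p.1 ≤ N ∧ ∃ k : ι → ℤ, ∀ i,
      |(k i : ℝ) - N * c i - (p.2 i : ℝ)| < 1 / ((p.1 : ℝ) + 1)})
    (fun p => isOpen_setOf_exists_int_near (fun i => (p.2 i : ℝ)) p.1 _)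
    (fun p => dense_setOf_exists_int_near (fun i => (p.2 i : ℝ)) p.1 (by positivity))
  have hpos : IsOpen {c : ι → ℝ | ∀ i, 0 < c i} := by
    simp only [Set.ofPred_forall]
    exact isOpen_iInter_of_finite fun i => isOpen_lt continuous_const (continuous_apply i)
  obtain ⟨c, hc0, hc⟩ := hD.inter_open_nonempty _ hpos ⟨fun _ => 1, fun _ => one_pos⟩
  rw [Set.mem_iInter] at hc
  refine ⟨c, Metric.dense_iff.mpr fun t ε hε => ?_⟩
  choose q hq using fun i => exists_rat_near (t i) (half_pos hε)
  have hlarge : ∀ᶠ M : ℕ in atTop, 1 / ((M : ℝ) + 1) < ε / 2 ∧ ∀ i, ε - t i < M * c i := by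
    refine (tendsto_one_div_add_atTop_nhds_zero_nat.eventually_lt_const (half_pos hε)).and ?_
    rw [eventually_all]
    intro i
    exact (tendsto_natCast_atTop_atTop.atTop_mul_const (hc0 i)).eventually_gt_atTop _
  obtain ⟨M, hM, hMt⟩ := hlarge.exists
  obtain ⟨N, hMN, k, hk⟩ := hc (M, q)
  simp only at hMN hk
  have hnear : ∀ i, |(k i : ℝ) - N * c i - t i| < ε := fun i => by
    have h1 := (hk i).trans hM
    have h2 := hq i
    rw [abs_lt] at h1 h2 ⊢
    constructor <;> linarith
  have hk0 : ∀ i, 0 ≤ k i := fun i => by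
    have h1 := (abs_lt.mp (hnear i)).1
    have h2 := hMt i
    have h3 : (M : ℝ) * c i ≤ N * c i :=
      mul_le_mul_of_nonneg_right (by exact_mod_cast hMN) (hc0 i).le
    have : (0 : ℝ) < k i := by linarith
    exact_mod_cast this.le
  refine ⟨fun i => (k i : ℝ) - N * c i, ?_, N, fun i => (k i).toNat, ?_⟩
  · rw [Metric.mem_ball, dist_pi_lt_iff hε]
    intro i
    rw [Real.dist_eq]
    exact hnear i
  · funext i
    have : (((k i).toNat : ℤ) : ℝ) = k i := by rw [Int.toNat_of_nonneg (hk0 i)]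
    rw [← this, Int.cast_natCast]

section Existence

variable {A : Type*} [NormedCommRing A] [NormedAlgebra ℂ A] [FiniteDimensional ℂ A]

theorem exists_dense_pow_mul_prod_pow {ι κ : Type*} [Fintype ι] [Fintype κ] (v : ι → A) (w : κ → A)
    (hw : ∀ k, NormedSpace.exp (w k) = 1)
    (hspan : ∀ a : A, ∃ (s : ι → ℝ) (t : κ → ℝ),
      a = ∑ i, (s i : ℂ) • v i + ∑ k, (t k : ℂ) • w k) :
    ∃ b : A, Dense {a : A | ∃ (N : ℕ) (k : ι → ℕ), a = b ^ N * ∏ i, NormedSpace.exp (v i) ^ k i} := by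
  have : CompleteSpace A := FiniteDimensional.complete ℂ A
  obtain ⟨c, hc⟩ := exists_dense_natCast_sub_natCast_mul (ι ⊕ κ)
  set u : ι ⊕ κ → A := Sum.elim v w
  set F : (ι ⊕ κ → ℝ) → A := fun x => NormedSpace.exp (∑ j, (x j : ℂ) • u j)
  have hF : Continuous F := by
    refine continuous_exp_of_complex.comp (continuous_finsetSum _ fun j _ => ?_)
    exact (Complex.continuous_ofReal.comp (continuous_apply j)).smul continuous_const
  refine ⟨NormedSpace.exp (-∑ j, (c j : ℂ) • u j), Dense.of_closure (dense_isUnit.mono ?_)⟩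
  intro a ha
  obtain ⟨l, rfl⟩ := isUnit_iff_exists_exp_eq.mp ha
  obtain ⟨s, t, rfl⟩ := hspan l
  have hst : NormedSpace.exp (∑ i, (s i : ℂ) • v i + ∑ k, (t k : ℂ) • w k) = F (Sum.elim s t) := by
    simp [F, u]
  rw [hst]
  refine map_mem_closure hF (hc _) ?_
  rintro _ ⟨N, k, rfl⟩
  refine ⟨N, fun i => k (Sum.inl i), ?_⟩
  have h1 : ∑ j, ((((k j : ℝ) - N * c j : ℝ)) : ℂ) • u j =
      N • (-∑ j, (c j : ℂ) • u j) + ∑ j, k j • u j := by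
    rw [smul_neg, Finset.smul_sum, neg_add_eq_sub, ← Finset.sum_sub_distrib]
    refine Finset.sum_congr rfl fun j _ => ?_
    push_cast
    rw [sub_smul, mul_smul, Nat.cast_smul_eq_nsmul, Nat.cast_smul_eq_nsmul]
  have h2 : ∀ j, NormedSpace.exp (k j • u j) = NormedSpace.exp (u j) ^ k j :=
    fun j => exp_nsmul_of_complex _ _
  simp only [F]
  rw [h1, exp_add_of_complex, exp_nsmul_of_complex, exp_sum_of_complex]
  simp only [h2]
  rw [Fintype.prod_sum_type]
  simp [u, hw]

end Existence

section MulConj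

variable {A X : Type*} [NormedCommRing A] [NormedAlgebra ℂ A] [TopologicalSpace X] [AddCommGroup X]
  [Module ℂ X]

/-- Multiplication in `A`, transported to an operator on `X` by an isomorphism `A ≃L[ℂ] X`. -/
noncomputable def mulConj (e : A ≃L[ℂ] X) : A →* (X →L[ℂ] X) where
  toFun a := (e : A →L[ℂ] X) ∘L (ContinuousLinearMap.mul ℂ A a) ∘L (e.symm : X →L[ℂ] A)
  map_one' := by ext x; simp
  map_mul' a b := by ext x; simp [mul_assoc]

@[simp]
theorem mulConj_apply (e : A ≃L[ℂ] X) (a : A) (x : X) : mulConj e a x = e (a * e.symm x) := rfl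

theorem isHypercyclicTuple_mulConj (e : A ≃L[ℂ] X) {m : ℕ} (t : Fin m → A)
    (ht : Dense {a : A | ∃ k : Fin m → ℕ, a = ∏ j, t j ^ k j}) :
    IsHypercyclicTuple fun j => mulConj e (t j) := by
  refine ⟨fun j k => by rw [← map_mul, mul_comm, map_mul], e 1, ?_⟩
  refine (e.surjective.denseRange.dense_image e.continuous ht).mono ?_
  rintro _ ⟨_, ⟨k, rfl⟩, rfl⟩
  refine ⟨_, ⟨k, rfl⟩, ?_⟩
  have h : (List.ofFn fun j => mulConj e (t j) ^ k j).prod = mulConj e (∏ j, t j ^ k j) := by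
    rw [← List.prod_ofFn, map_list_prod, List.map_ofFn]
    simp [Function.comp_def]
  rw [h]
  simp

theorem isHypercyclicTuple_mulConj_cons (e : A ≃L[ℂ] X) {m : ℕ} {ι : Type*} [Fintype ι]
    (σ : Fin m ≃ ι) (b : A) (t : ι → A)
    (ht : Dense {a : A | ∃ (N : ℕ) (k : ι → ℕ), a = b ^ N * ∏ i, t i ^ k i}) :
    IsHypercyclicTuple fun j : Fin (m + 1) =>
      mulConj e ((Fin.cons b (t ∘ σ) : Fin (m + 1) → A) j) := by
  refine isHypercyclicTuple_mulConj e _ (ht.mono ?_)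
  rintro _ ⟨N, k, rfl⟩
  refine ⟨Fin.cons N (k ∘ σ), ?_⟩
  rw [Fin.prod_univ_succ]
  simp only [Fin.cons_zero, Fin.cons_succ, Function.comp_apply]
  rw [Equiv.prod_comp σ fun i => t i ^ k i]

theorem not_isDiagonalizableTuple_mulConj {A X : Type u} [NormedCommRing A] [NormedAlgebra ℂ A]
    [TopologicalSpace X] [AddCommGroup X] [Module ℂ X] (e : A ≃L[ℂ] X) {m : ℕ} (t : Fin m → A)
    {j : Fin m} (hj : t j ≠ 1) (hj2 : (t j - 1) * (t j - 1) = 0) :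
    ¬ IsDiagonalizableTuple fun j => mulConj e (t j) := by
  rintro ⟨ι, b, hb⟩
  have key : ∀ i, (t j - 1) * e.symm (b i) = 0 := by
    intro i
    obtain ⟨c, hc⟩ := hb j i
    have h1 : t j * e.symm (b i) = c • e.symm (b i) := by
      apply e.injective
      simpa using hc
    have h2 : (t j - 1) * e.symm (b i) = (c - 1) • e.symm (b i) := by
      rw [sub_mul, h1, sub_smul, one_mul, one_smul]
    have h3 : (c - 1) • (c - 1) • e.symm (b i) = 0 := by
      rw [← h2, ← mul_smul_comm, ← h2, ← mul_assoc, hj2, zero_mul]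
    rcases smul_eq_zero.mp h3 with h | h
    · rw [h2, h, zero_smul]
    · rw [h2, h]
  have h0 : LinearMap.mulLeft ℂ (t j - 1) = 0 :=
    (b.map e.symm.toLinearEquiv).ext fun i => by simpa using key i
  have := congrArg (fun f => f 1) h0
  simp only [LinearMap.mulLeft_apply, mul_one, LinearMap.zero_apply] at this
  exact hj (sub_eq_zero.mp this)

end MulConj

theorem exp_two_pi_mul_I_eq_one : NormedSpace.exp (2 * Real.pi * Complex.I : ℂ) = 1 := by
  rw [← Complex.exp_eq_exp_ℂ, Complex.exp_two_pi_mul_I]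

theorem Complex.eq_re_add_div_mul_two_pi_I (z : ℂ) :
    z = (z.re : ℂ) + ((z.im / (2 * Real.pi) : ℝ) : ℂ) * (2 * Real.pi * Complex.I) := by
  have : (Real.pi : ℂ) ≠ 0 := by exact_mod_cast Real.pi_ne_zero
  conv_lhs => rw [← Complex.re_add_im z]
  push_cast
  field_simp

theorem Pi.exp_single_eq_one {ι : Type*} [Fintype ι] [DecidableEq ι] (i : ι) {z : ℂ}
    (hz : NormedSpace.exp z = 1) : NormedSpace.exp (Pi.single i z : ι → ℂ) = 1 := by
  rw [Pi.exp_def]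
  funext j
  by_cases h : j = i
  · subst h; simpa using hz
  · simp [h]

theorem exists_isHypercyclicTuple_succ (n : ℕ) :
    ∃ T : Fin (n + 1) → (Fin n → ℂ) →L[ℂ] (Fin n → ℂ), IsHypercyclicTuple T := by
  obtain ⟨b, hb⟩ := exists_dense_pow_mul_prod_pow (A := Fin n → ℂ)
    (fun i : Fin n => Pi.single i 1) (fun i : Fin n => Pi.single i (2 * Real.pi * Complex.I))
    (fun i => Pi.exp_single_eq_one i exp_two_pi_mul_I_eq_one)
    (fun a => ⟨fun i => (a i).re, fun i => (a i).im / (2 * Real.pi), by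
      funext j
      simp only [Pi.add_apply, Finset.sum_apply, Pi.smul_apply, Pi.single_apply, smul_eq_mul,
        mul_ite, mul_zero, mul_one, Finset.sum_ite_eq, Finset.mem_univ, if_true]
      exact Complex.eq_re_add_div_mul_two_pi_I (a j)⟩)
  exact ⟨_, isHypercyclicTuple_mulConj_cons (.refl ℂ _) (Equiv.refl _) b _ hb⟩

/-- The product of `p` copies of `ℂ` and the dual numbers. -/
abbrev PiProdDual (p : ℕ) : Type := (Fin p → ℂ) × TrivSqZeroExt ℂ ℂ

noncomputable def piProdDualEquiv (p : ℕ) : PiProdDual p ≃ₗ[ℂ] (Fin p → ℂ) × (ℂ × ℂ) :=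
  (LinearEquiv.refl ℂ _).prodCongr (LinearEquiv.refl ℂ (ℂ × ℂ))

instance (p : ℕ) : FiniteDimensional ℂ (PiProdDual p) :=
  (piProdDualEquiv p).symm.finiteDimensional

theorem finrank_piProdDual (p : ℕ) : Module.finrank ℂ (PiProdDual p) = p + 2 := by
  rw [(piProdDualEquiv p).finrank_eq]
  simp

theorem exists_isHypercyclicTuple_not_isDiagonalizableTuple (p : ℕ) :
    ∃ T : Fin (p + 2 + 2) → (Fin (p + 2) → ℂ) →L[ℂ] (Fin (p + 2) → ℂ),
      IsHypercyclicTuple T ∧ ¬ IsDiagonalizableTuple T := by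
  have hfr : Module.finrank ℂ (PiProdDual p) = Module.finrank ℂ (Fin (p + 2) → ℂ) := by
    rw [finrank_piProdDual]; simp
  let e : PiProdDual p ≃L[ℂ] (Fin (p + 2) → ℂ) := ContinuousLinearEquiv.ofFinrankEq hfr
  let v : Fin p ⊕ Fin 3 → PiProdDual p :=
    Sum.elim (fun i => (Pi.single i 1, 0))
      ![(0, TrivSqZeroExt.inr 1), (0, TrivSqZeroExt.inr Complex.I), (0, TrivSqZeroExt.inl 1)]
  let w : Fin p ⊕ Fin 1 → PiProdDual p :=
    Sum.elim (fun i => (Pi.single i (2 * Real.pi * Complex.I), 0))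
      (fun _ => (0, TrivSqZeroExt.inl (2 * Real.pi * Complex.I)))
  have hexp : ∀ (x : Fin p → ℂ) (y : TrivSqZeroExt ℂ ℂ),
      NormedSpace.exp ((x, y) : PiProdDual p) = (NormedSpace.exp x, NormedSpace.exp y) := by
    intro x y
    let : NormedAlgebra ℚ (TrivSqZeroExt ℂ ℂ) := .restrictScalars ℚ ℂ _
    exact Prod.ext (Prod.fst_exp _) (Prod.snd_exp _)
  obtain ⟨b, hb⟩ := exists_dense_pow_mul_prod_pow v w
    (by
      rintro (i | i)
      · simp only [w, Sum.elim_inl]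
        rw [hexp, Pi.exp_single_eq_one i exp_two_pi_mul_I_eq_one, NormedSpace.exp_zero]
        rfl
      · simp only [w, Sum.elim_inr]
        rw [hexp, TrivSqZeroExt.exp_inl, exp_two_pi_mul_I_eq_one, NormedSpace.exp_zero]
        rfl)
    (fun a => ⟨Sum.elim (fun i => (a.1 i).re) ![a.2.snd.re, a.2.snd.im, a.2.fst.re],
      Sum.elim (fun i => (a.1 i).im / (2 * Real.pi)) (fun _ => a.2.fst.im / (2 * Real.pi)), by
        refine Prod.ext ?_ (TrivSqZeroExt.ext ?_ ?_)
        · funext j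
          simp [v, w, Fin.sum_univ_three, Prod.fst_sum, Pi.single_apply, Finset.sum_apply,
            -Complex.coe_smul]
          have h := Complex.eq_re_add_div_mul_two_pi_I (a.1 j)
          push_cast at h
          exact h
        · simp [v, w, Fin.sum_univ_three, Prod.snd_sum, -Complex.coe_smul]
          have h := Complex.eq_re_add_div_mul_two_pi_I a.2.fst
          push_cast at h
          exact h
        · simp [v, w, Fin.sum_univ_three, Prod.snd_sum, -Complex.coe_smul]⟩)
  refine ⟨_, isHypercyclicTuple_mulConj_cons e (m := p + 3) finSumFinEquiv.symm b _ hb,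
    not_isDiagonalizableTuple_mulConj e _
      (j := Fin.succ (finSumFinEquiv (Sum.inr 0 : Fin p ⊕ Fin 3))) ?_ ?_⟩
  · simp [v, hexp]
    intro h
    simpa using congrArg TrivSqZeroExt.snd h
  · simp [v, hexp]
    ext <;> simp

/-- A finitely generated dense subgroup of a nonzero real vector space needs more generators than
the dimension. -/
theorem finrank_lt_card_of_dense_closure {E κ : Type*} [NormedAddCommGroup E] [NormedSpace ℝ E]
    [FiniteDimensional ℝ E] [Fintype κ] (v : κ → E) (hE : 0 < Module.finrank ℝ E)
    (h : Dense (AddSubgroup.closure (Set.range v) : Set E)) :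
    Module.finrank ℝ E < Fintype.card κ := by
  have hspan : Submodule.span ℝ (Set.range v) = ⊤ := by
    have hle : (AddSubgroup.closure (Set.range v) : Set E) ⊆ Submodule.span ℝ (Set.range v) :=
      (AddSubgroup.closure_le (K := (Submodule.span ℝ (Set.range v)).toAddSubgroup)).mpr
        Submodule.subset_span
    have hcl : IsClosed (Submodule.span ℝ (Set.range v) : Set E) :=
      Submodule.closed_of_finiteDimensional _
    rw [← SetLike.coe_set_eq, ← hcl.closure_eq, (h.mono hle).closure_eq, Submodule.top_coe]
  by_contra! hlt
  have hge : Module.finrank ℝ E ≤ Fintype.card κ := by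
    have := finrank_range_le_card (R := ℝ) v
    rwa [Set.finrank, hspan, finrank_top] at this
  let b := basisOfTopLeSpanOfCardEqFinrank v hspan.ge (le_antisymm hlt hge)
  have hb : ∀ j, b j = v j := fun j => by simp [b]
  have : Nonempty κ := Fintype.card_pos_iff.mp (hE.trans_le hge)
  obtain ⟨i⟩ := this
  have hcont : Continuous (b.coord i) := LinearMap.continuous_of_finiteDimensional _
  have hsurj : Function.Surjective (b.coord i) := fun r => ⟨r • b i, by simp⟩
  have hd := hsurj.denseRange.dense_image hcont h
  have hint : b.coord i '' (AddSubgroup.closure (Set.range v) : Set E) ⊆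
      Set.range ((↑) : ℤ → ℝ) := by
    have : AddSubgroup.closure (Set.range v) ≤
        ((Int.castAddHom ℝ).range).comap (b.coord i).toAddMonoidHom := by
      rw [AddSubgroup.closure_le]
      rintro _ ⟨j, rfl⟩
      rw [← hb]
      by_cases hij : j = i
      · exact ⟨1, by simp [hij]⟩
      · exact ⟨0, by simp [hij]⟩
    rintro _ ⟨x, hx, rfl⟩
    obtain ⟨z, hz⟩ := this hx
    exact ⟨z, hz⟩
  have hcl := Int.isClosedEmbedding_coe_real.isClosed_range.closure_eq
  rw [(hd.mono hint).closure_eq] at hcl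
  obtain ⟨z, hz⟩ : (1 / 2 : ℝ) ∈ Set.range ((↑) : ℤ → ℝ) := hcl ▸ Set.mem_univ _
  have h2 : ((2 * z : ℤ) : ℝ) = ((1 : ℤ) : ℝ) := by push_cast; rw [hz]; norm_num
  have h3 := Int.cast_injective h2
  omega

section ExpKernel

variable (A : Type*) [NormedCommRing A] [NormedAlgebra ℂ A]

/-- The kernel of the exponential map. -/
def expKernel : Set A := {a | NormedSpace.exp a = 1}

variable {A}

theorem exists_norm_exp_smul_le [CompleteSpace A] {w : A}
    (hw : w ∈ Submodule.span ℝ (expKernel A)) :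
    ∃ C, ∀ s : ℝ, ‖NormedSpace.exp (s • w)‖ ≤ C := by
  induction hw using Submodule.span_induction with
  | mem a ha =>
    have hper : Function.Periodic (fun s : ℝ => NormedSpace.exp (s • a)) 1 := fun s => by
      have h1 : NormedSpace.exp a = 1 := ha
      simp only [add_smul, one_smul]
      rw [exp_add_of_complex, h1, mul_one]
    have hc : Continuous fun s : ℝ => NormedSpace.exp (s • a) :=
      continuous_exp_of_complex.comp (by fun_prop)
    obtain ⟨C, hC⟩ := (hper.compact_of_continuous one_ne_zero hc).isBounded.exists_norm_le
    exact ⟨C, fun s => hC _ ⟨s, rfl⟩⟩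
  | zero => exact ⟨‖NormedSpace.exp (0 : A)‖, fun s => by rw [smul_zero]⟩
  | add x y _ _ hx hy =>
    obtain ⟨C, hC⟩ := hx
    obtain ⟨D, hD⟩ := hy
    refine ⟨C * D, fun s => ?_⟩
    rw [smul_add, exp_add_of_complex]
    exact (norm_mul_le _ _).trans
      (mul_le_mul (hC s) (hD s) (norm_nonneg _) ((norm_nonneg _).trans (hC s)))
  | smul c x _ hx =>
    obtain ⟨C, hC⟩ := hx
    exact ⟨C, fun s => by rw [smul_smul]; exact hC _⟩

theorem eq_zero_of_mem_span_expKernel [CompleteSpace A] {w : A}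
    (hw : w ∈ Submodule.span ℝ (expKernel A))
    (hw' : Complex.I • w ∈ Submodule.span ℝ (expKernel A)) : w = 0 := by
  obtain ⟨C, hC⟩ := exists_norm_exp_smul_le hw
  obtain ⟨D, hD⟩ := exists_norm_exp_smul_le hw'
  have hder : ∀ z : ℂ, HasDerivAt (fun u : ℂ => NormedSpace.exp (u • w))
      (NormedSpace.exp (z • w) * w) z := fun z => hasDerivAt_exp_smul_const w z
  have hbdd : Bornology.IsBounded (Set.range fun u : ℂ => NormedSpace.exp (u • w)) := by
    refine isBounded_iff_forall_norm_le.mpr ⟨C * D, ?_⟩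
    rintro _ ⟨z, rfl⟩
    have hz : z • w = z.re • w + z.im • (Complex.I • w) := by
      conv_lhs => rw [← Complex.re_add_im z]
      rw [add_smul, mul_smul, Complex.coe_smul, Complex.coe_smul]
    simp only [hz]
    rw [exp_add_of_complex]
    exact (norm_mul_le _ _).trans
      (mul_le_mul (hC _) (hD _) (norm_nonneg _) ((norm_nonneg _).trans (hC 0)))
  have hconst : (fun u : ℂ => NormedSpace.exp (u • w)) = fun _ => 1 := by
    funext z
    have := Differentiable.apply_eq_apply_of_bounded
      (fun z => (hder z).differentiableAt) hbdd z 0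
    simpa using this
  have h0 := hder 0
  rw [hconst] at h0
  have := h0.unique (hasDerivAt_const (0 : ℂ) (1 : A))
  simpa using this

theorem exists_add_mem_expKernel_of_dense [CompleteSpace A] {κ : Type*} [Fintype κ] {a : κ → A}
    (h : Dense {x : A | ∃ k : κ → ℕ, x = ∏ j, NormedSpace.exp (a j) ^ k j}) :
    Dense {x : A | ∃ k : κ → ℕ, ∃ b ∈ expKernel A, x = ∑ j, k j • a j + b} := by
  rw [dense_iff_inter_open]
  rintro U hU ⟨x, hx⟩
  have hU0 : (fun u => x + u) ⁻¹' U ∈ 𝓝 (0 : A) :=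
    (hU.preimage (by fun_prop)).mem_nhds (by simpa using hx)
  have h1 : NormedSpace.exp '' ((fun u => x + u) ⁻¹' U) ∈ 𝓝 (1 : A) := by
    rw [← map_exp_nhds_zero]
    exact image_mem_map hU0
  have hc : Tendsto (fun y => y * NormedSpace.exp (-x)) (𝓝 (NormedSpace.exp x)) (𝓝 1) := by
    rw [← exp_mul_exp_neg x]
    exact (continuous_id.mul continuous_const).tendsto _
  obtain ⟨_, ⟨k, rfl⟩, u, hu, huy⟩ := h.inter_nhds_nonempty (hc h1)
  have hk : ∏ j, NormedSpace.exp (a j) ^ k j = NormedSpace.exp (∑ j, k j • a j) := by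
    rw [exp_sum_of_complex]
    exact Finset.prod_congr rfl fun j _ => (exp_nsmul_of_complex _ _).symm
  refine ⟨x + u, hu, k, x + u + -∑ j, k j • a j, ?_, by abel⟩
  have huy' : NormedSpace.exp u = NormedSpace.exp (∑ j, k j • a j) * NormedSpace.exp (-x) := by
    rw [← hk]; exact huy
  change NormedSpace.exp _ = 1
  rw [exp_add_of_complex, exp_add_of_complex, huy']
  have e1 := exp_mul_exp_neg x
  have e2 := exp_mul_exp_neg (∑ j, k j • a j)
  linear_combination
    (NormedSpace.exp (∑ j, k j • a j) * NormedSpace.exp (-∑ j, k j • a j)) * e1 + e2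

variable [FiniteDimensional ℂ A]

theorem finrank_span_expKernel_le_and_span_eq_top :
    Module.finrank ℝ (Submodule.span ℝ (expKernel A)) ≤ Module.finrank ℂ A ∧
    (Module.finrank ℂ A ≤ Module.finrank ℝ (Submodule.span ℝ (expKernel A)) →
      Submodule.span ℂ (expKernel A) = ⊤) := by
  have : CompleteSpace A := FiniteDimensional.complete ℂ A
  have hfdR : FiniteDimensional ℝ A := FiniteDimensional.complexToReal A
  have h2 : Module.finrank ℝ A = 2 * Module.finrank ℂ A := finrank_real_of_complex A
  set W := Submodule.span ℝ (expKernel A) with hW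
  let J : A ≃ₗ[ℝ] A :=
    (LinearEquiv.smulOfNeZero ℂ A Complex.I Complex.I_ne_zero).restrictScalars ℝ
  have hJ : ∀ a, J a = Complex.I • a := fun a => rfl
  have hJW : Module.finrank ℝ (W.map (J : A →ₗ[ℝ] A)) = Module.finrank ℝ W :=
    LinearEquiv.finrank_map_eq J W
  have hdisj : W ⊓ W.map (J : A →ₗ[ℝ] A) = ⊥ := by
    rw [eq_bot_iff]
    rintro x ⟨hx, y, hy, rfl⟩
    have : y = 0 := eq_zero_of_mem_span_expKernel hy hx
    simp [this]
  have hsum := Submodule.finrank_sup_add_finrank_inf_eq W (W.map (J : A →ₗ[ℝ] A))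
  rw [hdisj, finrank_bot, add_zero, hJW] at hsum
  have hle := Submodule.finrank_le (W ⊔ W.map (J : A →ₗ[ℝ] A))
  refine ⟨by omega, fun hge => ?_⟩
  have htop : W ⊔ W.map (J : A →ₗ[ℝ] A) = ⊤ :=
    Submodule.eq_top_of_finrank_eq (by omega)
  have hWle : ∀ x ∈ W, x ∈ Submodule.span ℂ (expKernel A) :=
    Submodule.span_le_restrictScalars ℝ ℂ (expKernel A)
  rw [eq_top_iff]
  rintro x -
  obtain ⟨y, hy, _, ⟨z, hz, rfl⟩, rfl⟩ := Submodule.mem_sup.mp (htop ▸ Submodule.mem_top : x ∈ _)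
  exact add_mem (hWle y hy) (Submodule.smul_mem _ _ (hWle z hz))

/-- Counting generators of a dense subsemigroup of the units. -/
theorem finrank_lt_card_of_dense_exp {κ : Type*} [Fintype κ] {a : κ → A}
    (hn : 0 < Module.finrank ℂ A)
    (h : Dense {x : A | ∃ k : κ → ℕ, x = ∏ j, NormedSpace.exp (a j) ^ k j}) :
    Module.finrank ℂ A < Fintype.card κ ∧
    (Fintype.card κ ≤ Module.finrank ℂ A + 1 → Submodule.span ℂ (expKernel A) = ⊤) := by
  have : CompleteSpace A := FiniteDimensional.complete ℂ A
  have hfdR : FiniteDimensional ℝ A := FiniteDimensional.complexToReal A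
  have h2 : Module.finrank ℝ A = 2 * Module.finrank ℂ A := finrank_real_of_complex A
  obtain ⟨hle, htop⟩ := finrank_span_expKernel_le_and_span_eq_top (A := A)
  set W := Submodule.span ℝ (expKernel A) with hW
  have hq := Submodule.finrank_quotient_add_finrank W
  let E := Fin (Module.finrank ℝ (A ⧸ W)) → ℝ
  let e : (A ⧸ W) ≃ₗ[ℝ] E := LinearEquiv.ofFinrankEq _ _ (by simp [E])
  let π : A →ₗ[ℝ] E := (e : (A ⧸ W) →ₗ[ℝ] E) ∘ₗ W.mkQ
  have hπc : Continuous π := π.continuous_of_finiteDimensional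
  have hπs : Function.Surjective π := e.surjective.comp W.mkQ_surjective
  have hd := hπs.denseRange.dense_image hπc (exists_add_mem_expKernel_of_dense h)
  have hE : Module.finrank ℝ E = Module.finrank ℝ (A ⧸ W) := by simp [E]
  have hlt := finrank_lt_card_of_dense_closure (fun j => π (a j)) (by rw [hE]; omega)
    (hd.mono (by
      rintro _ ⟨_, ⟨k, b, hb, rfl⟩, rfl⟩
      have hb0 : π b = 0 := by
        have : W.mkQ b = 0 := by simpa using Submodule.subset_span hb
        simp only [π, LinearMap.comp_apply, this, map_zero]
      rw [map_add, hb0, add_zero, map_sum]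
      refine sum_mem fun j _ => ?_
      rw [map_nsmul]
      exact AddSubgroup.nsmul_mem _ (AddSubgroup.subset_closure (Set.mem_range_self j)) _))
  rw [hE] at hlt
  exact ⟨by omega, fun hc => htop (by omega)⟩

end ExpKernel

section LowerBound

variable {A : Type*} [NormedCommRing A] [NormedAlgebra ℂ A]

theorem exp_mul_of_mul_mul_eq_zero [CompleteSpace A] {N v : A} (h : N * (N * v) = 0) :
    NormedSpace.exp N * v = v + N * v := by
  have h1 := (NormedSpace.exp_series_hasSum_exp' (𝕂 := ℂ) N).mul_right v
  have h2 := hasSum_sum_of_ne_finset_zero (L := .unconditional ℕ) (s := Finset.range 2)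
    (f := fun n : ℕ => ((n.factorial : ℂ)⁻¹ • N ^ n) * v) (fun n hn => by
      obtain ⟨k, rfl⟩ : ∃ k, n = k + 2 := ⟨n - 2, by simp at hn; omega⟩
      have : N ^ (k + 2) * v = 0 := by
        rw [pow_add, mul_assoc, pow_two, mul_assoc, h, mul_zero]
      rw [smul_mul_assoc, this, smul_zero])
  rw [h1.unique h2]
  simp [Finset.sum_range_succ]

/-- Multiplication by an element of the kernel of `exp` is a semisimple operator. -/
theorem mul_eq_zero_of_mem_expKernel [CompleteSpace A] {a v : A} (ha : a ∈ expKernel A) (μ : ℂ)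
    (h : (a - algebraMap ℂ A μ) * ((a - algebraMap ℂ A μ) * v) = 0) :
    (a - algebraMap ℂ A μ) * v = 0 := by
  have hexp : ∀ x : A, NormedSpace.exp μ • (NormedSpace.exp (a - algebraMap ℂ A μ) * x) = x := by
    intro x
    have h1 : NormedSpace.exp (algebraMap ℂ A μ + (a - algebraMap ℂ A μ)) = 1 := by
      rw [add_sub_cancel]; exact ha
    rw [exp_add_of_complex, ← NormedSpace.algebraMap_exp_comm] at h1
    rw [Algebra.smul_def, ← mul_assoc, h1, one_mul]
  have h1 := hexp v
  have h2 := hexp ((a - algebraMap ℂ A μ) * v)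
  rw [exp_mul_of_mul_mul_eq_zero h] at h1
  rw [exp_mul_of_mul_mul_eq_zero (by rw [h, mul_zero]), h, add_zero] at h2
  by_cases hc : NormedSpace.exp μ = 1
  · rw [hc, one_smul] at h1
    simpa using h1
  · have h3 : (NormedSpace.exp μ - 1) • ((a - algebraMap ℂ A μ) * v) = 0 := by
      rw [sub_smul, h2, one_smul, sub_self]
    exact (smul_eq_zero.mp h3).resolve_left (sub_ne_zero.mpr hc)

theorem mul_eq_zero_of_pow_mul_eq_zero [CompleteSpace A] {a : A} (ha : a ∈ expKernel A) (μ : ℂ)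
    (k : ℕ) {v : A} (h : (a - algebraMap ℂ A μ) ^ k * v = 0) :
    (a - algebraMap ℂ A μ) * v = 0 := by
  induction k with
  | zero => rw [pow_zero, one_mul] at h; rw [h, mul_zero]
  | succ k ih =>
    cases k with
    | zero => simpa using h
    | succ k =>
      refine ih ?_
      rw [pow_succ', mul_assoc]
      refine mul_eq_zero_of_mem_expKernel ha μ ?_
      rwa [pow_succ', pow_succ', mul_assoc, mul_assoc] at h

variable [FiniteDimensional ℂ A]

theorem finrank_lt_of_dense_prod_pow {m : ℕ} {t : Fin m → A} (hn : 0 < Module.finrank ℂ A)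
    (h : Dense {x : A | ∃ k : Fin m → ℕ, x = ∏ j, t j ^ k j}) :
    Module.finrank ℂ A < m ∧
    (m ≤ Module.finrank ℂ A + 1 → Submodule.span ℂ (expKernel A) = ⊤) := by
  classical
  have : CompleteSpace A := FiniteDimensional.complete ℂ A
  choose a ha using fun j : {j // IsUnit (t j)} => isUnit_iff_exists_exp_eq.mp j.2
  have hopen : IsOpen {x : A | IsUnit x} := Units.isOpen
  have hdense : Dense {x : A | ∃ k : {j // IsUnit (t j)} → ℕ,
      x = ∏ j, NormedSpace.exp (a j) ^ k j} := by
    refine (h.inter_of_isOpen_right dense_isUnit hopen).mono ?_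
    rintro _ ⟨⟨k, rfl⟩, hu⟩
    have hk : ∀ j, ¬ IsUnit (t j) → k j = 0 := fun j hj => by
      by_contra hkj
      have h1 : IsUnit (t j ^ k j) :=
        isUnit_of_dvd_unit (Finset.dvd_prod_of_mem (fun i => t i ^ k i) (Finset.mem_univ j)) hu
      exact hj ((isUnit_pow_iff hkj).mp h1)
    refine ⟨fun j => k j, ?_⟩
    rw [← Fintype.prod_subtype_mul_prod_subtype fun j => IsUnit (t j)]
    rw [Finset.prod_eq_one (s := (Finset.univ : Finset {j // ¬ IsUnit (t j)}))
      (fun j _ => by rw [hk j j.2, pow_zero]), mul_one]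
    exact Finset.prod_congr rfl fun j _ => by rw [ha]
  obtain ⟨h1, h2⟩ := finrank_lt_card_of_dense_exp hn hdense
  have hcard : Fintype.card {j // IsUnit (t j)} ≤ m := by
    simpa using Fintype.card_subtype_le fun j => IsUnit (t j)
  exact ⟨by omega, fun hm => h2 (by omega)⟩

theorem span_eigenvectors_eq_top (hs : Submodule.span ℂ (expKernel A) = ⊤) :
    Submodule.span ℂ {v : A | ∀ a : A, ∃ c : ℂ, a * v = c • v} = ⊤ := by
  have : CompleteSpace A := FiniteDimensional.complete ℂ A
  have htop := Module.End.iSup_iInf_maxGenEigenspace_eq_top_of_iSup_maxGenEigenspace_eq_top_of_commute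
    (fun a : expKernel A => Algebra.lmul ℂ A (a : A))
    (fun a b _ => (Commute.all (a : A) (b : A)).map (Algebra.lmul ℂ A))
    (fun a => Module.End.iSup_maxGenEigenspace_eq_top _)
  rw [eq_top_iff, ← htop]
  refine iSup_le fun χ v hv => Submodule.subset_span fun x => ?_
  have hx : x ∈ Submodule.span ℂ (expKernel A) := hs ▸ Submodule.mem_top
  induction hx using Submodule.span_induction with
  | mem a ha =>
    obtain ⟨k, hk⟩ := (Module.End.mem_iInf_maxGenEigenspace_iff _ _ _).mp hv ⟨a, ha⟩
    refine ⟨χ ⟨a, ha⟩, ?_⟩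
    have h1 : Algebra.lmul ℂ A a - χ ⟨a, ha⟩ • (1 : Module.End ℂ A) =
        Algebra.lmul ℂ A (a - algebraMap ℂ A (χ ⟨a, ha⟩)) := by
      rw [map_sub, AlgHom.commutes, Algebra.algebraMap_eq_smul_one]
    have h2 : (a - algebraMap ℂ A (χ ⟨a, ha⟩)) ^ k * v = 0 := by
      have h3 : ((Algebra.lmul ℂ A a - χ ⟨a, ha⟩ • (1 : Module.End ℂ A)) ^ k) v = 0 := hk
      rw [h1, ← map_pow] at h3
      exact h3
    have h4 := mul_eq_zero_of_pow_mul_eq_zero ha _ k h2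
    rwa [sub_mul, ← Algebra.smul_def, sub_eq_zero] at h4
  | zero => exact ⟨0, by simp⟩
  | add x y _ _ hx hy =>
    obtain ⟨c, hc⟩ := hx
    obtain ⟨d, hd⟩ := hy
    exact ⟨c + d, by rw [add_mul, hc, hd, add_smul]⟩
  | smul r x _ hx =>
    obtain ⟨c, hc⟩ := hx
    exact ⟨r * c, by rw [smul_mul_assoc, hc, smul_smul]⟩

end LowerBound

section Hypercyclic

variable {X : Type u} [NormedAddCommGroup X] [NormedSpace ℂ X] [FiniteDimensional ℂ X]

theorem IsHypercyclicTuple.finrank_lt {m : ℕ} {T : Fin m → X →L[ℂ] X}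
    (hn : 0 < Module.finrank ℂ X) (hT : IsHypercyclicTuple T) :
    Module.finrank ℂ X < m ∧ (m ≤ Module.finrank ℂ X + 1 → IsDiagonalizableTuple T) := by
  obtain ⟨hcomm, x, hx⟩ := hT
  let B : Subalgebra ℂ (X →L[ℂ] X) := Algebra.adjoin ℂ (Set.range T)
  have hBcomm : ∀ a b : B, a * b = b * a := by
    have := Algebra.isMulCommutative_adjoin ℂ (s := Set.range T) (by
      rintro _ ⟨i, rfl⟩ _ ⟨j, rfl⟩
      exact hcomm i j)
    exact fun a b => mul_comm' a b
  let instB : NormedCommRing B := { (inferInstance : NormedRing B) with mul_comm := hBcomm }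
  let t : Fin m → B := fun j => ⟨T j, Algebra.subset_adjoin ⟨j, rfl⟩⟩
  let ev : B →ₗ[ℂ] X :=
    { toFun := fun S => (S : X →L[ℂ] X) x
      map_add' := fun _ _ => rfl
      map_smul' := fun _ _ => rfl }
  have hprod : ∀ k : Fin m → ℕ,
      ((∏ j, t j ^ k j : B) : X →L[ℂ] X) = (List.ofFn fun j => T j ^ k j).prod := by
    intro k
    have : (∏ j, t j ^ k j : B) = (List.ofFn fun j => t j ^ k j).prod := List.prod_ofFn.symm
    rw [this, ← Subalgebra.coe_val, map_list_prod, List.map_ofFn]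
    rfl
  have horbit : {y : X | ∃ S ∈ tupleSemigroup T, y = S x} ⊆
      ev '' {b : B | ∃ k : Fin m → ℕ, b = ∏ j, t j ^ k j} := by
    rintro _ ⟨_, ⟨k, rfl⟩, rfl⟩
    refine ⟨_, ⟨k, rfl⟩, ?_⟩
    rw [← hprod]
    rfl
  have hsurj : Function.Surjective ev := by
    rw [← LinearMap.range_eq_top, ← SetLike.coe_set_eq, Submodule.top_coe]
    have hcl : IsClosed (LinearMap.range ev : Set X) := Submodule.closed_of_finiteDimensional _
    rw [← hcl.closure_eq]
    exact (hx.mono (horbit.trans (Set.image_subset_range _ _))).closure_eq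
  have hinj : Function.Injective ev := by
    rw [← LinearMap.ker_eq_bot, LinearMap.ker_eq_bot']
    intro S hS
    refine Subtype.ext (ContinuousLinearMap.ext fun y => ?_)
    obtain ⟨R, rfl⟩ := hsurj y
    have h1 : ev (S * R) = ev (R * S) := by rw [hBcomm]
    have h2 : ev (R * S) = (R : X →L[ℂ] X) (ev S) := rfl
    rw [hS, map_zero] at h2
    exact h1.trans h2
  let e : B ≃ₗ[ℂ] X := LinearEquiv.ofBijective ev ⟨hinj, hsurj⟩
  have hfd : FiniteDimensional ℂ B := e.symm.finiteDimensional
  let ec : B ≃L[ℂ] X := e.toContinuousLinearEquiv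
  have hdense : Dense {b : B | ∃ k : Fin m → ℕ, b = ∏ j, t j ^ k j} := by
    have h1 := ec.symm.surjective.denseRange.dense_image ec.symm.continuous (hx.mono horbit)
    refine h1.mono ?_
    rintro _ ⟨_, ⟨b, hb, rfl⟩, rfl⟩
    have : ec.symm (ev b) = b := ec.symm_apply_apply b
    rw [this]
    exact hb
  have hfr : Module.finrank ℂ B = Module.finrank ℂ X := e.finrank_eq
  obtain ⟨h1, h2⟩ := finrank_lt_of_dense_prod_pow (by rw [hfr]; exact hn) hdense
  rw [hfr] at h1 h2
  refine ⟨h1, fun hm => ?_⟩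
  have hspan := span_eigenvectors_eq_top (h2 hm)
  let b := Module.Basis.ofSpan hspan.ge
  refine ⟨_, b.map e, fun j i => ?_⟩
  obtain ⟨c, hc⟩ := Module.Basis.ofSpan_subset hspan.ge ⟨i, rfl⟩ (t j)
  refine ⟨c, ?_⟩
  have h3 : e (t j * b i) = T j (e (b i)) := rfl
  rw [Module.Basis.map_apply, ← h3, hc, map_smul]

end Hypercyclic

theorem corollary1p4 (n : ℕ) (hn : 1 ≤ n) :
    IsLeast {m : ℕ | ∃ T : Fin m → (Fin n → ℂ) →L[ℂ] (Fin n → ℂ), IsHypercyclicTuple T} (n + 1) ∧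
    (¬ ∃ T : Fin n → (Fin n → ℂ) →L[ℂ] (Fin n → ℂ), IsHypercyclicTuple T) ∧
    (2 ≤ n →
      IsLeast {m : ℕ | ∃ T : Fin m → (Fin n → ℂ) →L[ℂ] (Fin n → ℂ),
        IsHypercyclicTuple T ∧ ¬ IsDiagonalizableTuple T} (n + 2)) := by
  have hfr : Module.finrank ℂ (Fin n → ℂ) = n := by simp
  have hlower : ∀ {m : ℕ} {T : Fin m → (Fin n → ℂ) →L[ℂ] (Fin n → ℂ)}, IsHypercyclicTuple T →
      n < m ∧ (m ≤ n + 1 → IsDiagonalizableTuple T) := fun hT => by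
    simpa only [hfr] using hT.finrank_lt (by omega)
  refine ⟨⟨exists_isHypercyclicTuple_succ n, ?_⟩, ?_, fun hn2 => ⟨?_, ?_⟩⟩
  · rintro m ⟨T, hT⟩
    exact (hlower hT).1
  · rintro ⟨T, hT⟩
    exact lt_irrefl n (hlower hT).1
  · obtain ⟨p, rfl⟩ := Nat.exists_eq_add_of_le' hn2
    exact exists_isHypercyclicTuple_not_isDiagonalizableTuple p
  · rintro m ⟨T, hT, hT'⟩
    by_contra hm
    exact hT' ((hlower hT).2 (by omega))
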